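/- Let $p>3$ be a prime, and put $\pounds_2(x)=\sum_{k=1}^{p-1}\frac{x^k}{k^2}$, $q_p(3)=\frac{3^{p-1}-1}{p}$, $\omega_6=e^{2\pi i/6}$. Let $\left(\frac{p}{3}\right)$ be the Legendre symbol and $B_n(x)$ the $n$-th Bernoulli polynomial. Then \begin{align*} \pounds_2\bigl(1+\omega_6^{\pm 1}\bigr)&\equiv -\frac{q_p(3)^2}{16}\left(3\pm i\sqrt{3}\left(\frac{p}{3}\right)\right)+\frac{1}{36}\left(3\left(\frac{p}{3}\right)\mp i\sqrt{3}\right)B_{p-2}(1/3) \pmod{p},\\ \pounds_2\bigl((1+\omega_6^{\pm 1})/3\bigr)&\equiv -\frac{q_p(3)^2}{8}+\frac{1}{36}\left(\left(\frac{p}{3}\right)\pm i\sqrt{3}\right)B_{p-2}(1/3) \pmod{p}, \end{align*} where in each line either all upper or all lower signs are taken. Both sides of each congruence are $p$-integral elements of $\mathbb{Q}(\omega_6)$, that is, quotients of an algebraic integer by an integer not divisible by $p$, and $x\equiv y\pmod p$ means that $(x-y)/p$ is $p$-integral. -/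

import Mathlib

/-- The finite polylogarithm `£_d(x) = ∑_{k=1}^{p-1} x^k / k^d` (relative to the prime `p`). -/
noncomputable def finitePolylog (p d : ℕ) (x : ℂ) : ℂ :=
  ∑ k ∈ Finset.Icc 1 (p - 1), x ^ k / (k : ℂ) ^ d

/-- The Fermat quotient `q_p(x) = (x^(p-1) - 1) / p`. -/
noncomputable def fermatQuotient (p : ℕ) (x : ℂ) : ℂ :=
  (x ^ (p - 1) - 1) / (p : ℂ)

/-- The primitive sixth root of unity `ω₆ = exp(2πi/6)`. -/
noncomputable def omegaSix : ℂ :=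
  Complex.exp (2 * (Real.pi : ℂ) * Complex.I / 6)

/-- `z` is a `p`-integral algebraic number: it is an algebraic integer divided by an integer
not divisible by `p`. On an element `z` of a number field `K ⊆ ℂ` this says that `z` lies in the
localization of the ring of integers of `K` at the integers prime to `p`; on rational numbers,
that `p` does not divide the reduced denominator. -/
def IsPIntegral (p : ℕ) (z : ℂ) : Prop :=
  ∃ s : ℤ, ¬ (p : ℤ) ∣ s ∧ IsIntegral ℤ ((s : ℂ) * z)

/-- The congruence `x ≡ y (mod p)` between `p`-integral algebraic numbers: both sides are
`p`-integral, and so is `(x - y) / p`. -/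
def CongrModP (p : ℕ) (x y : ℂ) : Prop :=
  IsPIntegral p x ∧ IsPIntegral p y ∧ ∃ z : ℂ, IsPIntegral p z ∧ x - y = (p : ℂ) * z

/-! Modulo `p`, write `L_d` for the finite polylogarithm as a polynomial over `ZMod p`. Granville's
identity `L_1(x)^2 + 2x^p L_2(x) + 2(1 - x^p) L_2(1 - x) = 0` (`polylogPoly_one_sq`) is evaluated at
`x = 1 + w` with `w^2 = w - 1`. Then `1 - x = -w` is a cube root of unity, so `L_2(1 + w)` follows
from `L_1(1 + w)` and `L_2(-w)`.

The value `L_1(1 + w)` is the reduction of `(1 - x^p - (1 - x)^p)/p`. As `(1 + w)^2 = 3w`, one has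
`(1 + w)^p = u(1 + w^p)` with `u = ±3^((p-1)/2)` and `u^2 = 1 + p q_p(3)`, whence `L_1(1 + w) = -(1
+ w^p) q_p(3)/2` (`exists_aeval_polylogPoly_one`).

Averaging `L_2` over the cube roots of unity keeps only the terms with `3 ∣ k`, so `L_2(-w)` is a
multiple of the sum of `1/j^2` over `j ≤ p/3` (`three_mul_aeval_polylogPoly_two`). By Fermat this is
a sum of powers `j^(p-3)`, hence a value of `B_{p-2}` at an integer congruent to `1/3` or `2/3`
(`exists_bernoulli_third`).

The second congruence follows by the inversion `x^p L_2(1/x) = L_2(x)`, because `(1 + w)/3` is the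
inverse of `1 + (1 - w)`, where `1 - w` is the conjugate of `w`. All of this takes place in the ring
of `p`-integral numbers modulo `p`, which is used only as a `ZMod p`-algebra. -/

open Polynomial in
/-- The finite polylogarithm as a polynomial over `ZMod p`. -/
noncomputable def polylogPoly (p d : ℕ) : (ZMod p)[X] :=
  ∑ k ∈ Finset.Icc 1 (p - 1), C ((k : ZMod p)⁻¹ ^ d) * X ^ k

/-! ### Polynomial identities for the finite polylogarithms over `ZMod p` -/

section PolynomialIdentities

open Polynomial

theorem natDegree_polylogPoly_le (p d : ℕ) : (polylogPoly p d).natDegree ≤ p - 1 := by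
  refine natDegree_sum_le_of_forall_le _ _ fun k hk => ?_
  rw [Finset.mem_Icc] at hk
  exact (natDegree_C_mul_X_pow_le _ _).trans hk.2

variable {p : ℕ} [hp : Fact p.Prime]

theorem natCast_ne_zero_of_mem_Icc {k : ℕ} (hk : k ∈ Finset.Icc 1 (p - 1)) :
    (k : ZMod p) ≠ 0 := by
  rw [Finset.mem_Icc] at hk
  rw [Ne, ZMod.natCast_eq_zero_iff]
  intro h
  have := Nat.le_of_dvd (by omega) h
  omega

/-- By Fermat `k^(-d) = k^(p-1-d)`, and power sums over a finite field vanish for exponents below `p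
- 1`. -/
theorem sum_Icc_inv_pow_eq_zero {d : ℕ} (hd0 : 0 < d) (hd : d < p - 1) :
    ∑ k ∈ Finset.Icc 1 (p - 1), (k : ZMod p)⁻¹ ^ d = 0 := by
  have h1 : ∀ k ∈ Finset.Icc 1 (p - 1), (k : ZMod p)⁻¹ ^ d = (k : ZMod p) ^ (p - 1 - d) := by
    intro k hk
    have hk0 := natCast_ne_zero_of_mem_Icc hk
    have h := ZMod.pow_card_sub_one_eq_one hk0
    rw [show p - 1 = (p - 1 - d) + d by omega, pow_add] at h
    rw [inv_pow]
    exact (eq_inv_of_mul_eq_one_left h).symm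
  rw [Finset.sum_congr rfl h1]
  have h2 : ∑ x : ZMod p, x ^ (p - 1 - d) = 0 :=
    FiniteField.sum_pow_lt_card_sub_one (ZMod p) _ (by rw [ZMod.card]; omega)
  rw [← h2]
  symm
  rw [← Finset.sum_subset (Finset.subset_univ (Finset.univ.erase (0 : ZMod p)))]
  · symm
    refine Finset.sum_bij (fun k _ => (k : ZMod p)) ?_ ?_ ?_ ?_
    · intro k hk
      simpa using natCast_ne_zero_of_mem_Icc hk
    · intro a ha b hb hab
      rw [Finset.mem_Icc] at ha hb
      rw [ZMod.natCast_eq_natCast_iff'] at hab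
      rwa [Nat.mod_eq_of_lt (by omega), Nat.mod_eq_of_lt (by omega)] at hab
    · intro b hb
      refine ⟨b.val, ?_, ZMod.natCast_zmod_val b⟩
      have hb0 : b ≠ 0 := by simpa using hb
      have h3 := ZMod.val_lt b
      have h4 : b.val ≠ 0 := by rwa [Ne, ZMod.val_eq_zero]
      rw [Finset.mem_Icc]
      omega
    · intro a _
      rfl
  · intro x _ hx
    have : x = 0 := by simpa using hx
    rw [this, zero_pow (by omega)]

theorem polylogPoly_eval_zero (d : ℕ) : (polylogPoly p d).eval 0 = 0 := by
  rw [polylogPoly, eval_finsetSum]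
  refine Finset.sum_eq_zero fun k hk => ?_
  rw [Finset.mem_Icc] at hk
  simp [zero_pow (show k ≠ 0 by omega)]

theorem polylogPoly_eval_one {d : ℕ} (hd0 : 0 < d) (hd : d < p - 1) :
    (polylogPoly p d).eval 1 = 0 := by
  rw [← sum_Icc_inv_pow_eq_zero hd0 hd, polylogPoly, eval_finsetSum]
  simp

theorem X_mul_derivative_polylogPoly (d : ℕ) :
    X * derivative (polylogPoly p (d + 1)) = polylogPoly p d := by
  rw [polylogPoly, polylogPoly, derivative_sum, Finset.mul_sum]
  refine Finset.sum_congr rfl fun k hk => ?_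
  have hk0 := natCast_ne_zero_of_mem_Icc hk
  rw [Finset.mem_Icc] at hk
  rw [derivative_C_mul_X_pow]
  obtain ⟨j, rfl⟩ : ∃ j, k = j + 1 := ⟨k - 1, by omega⟩
  rw [Nat.add_sub_cancel, pow_succ, mul_assoc, inv_mul_cancel₀ hk0, mul_one, pow_succ X]
  ring

theorem derivative_polylogPoly_one :
    (X - 1) * (X * derivative (polylogPoly p 1)) = X ^ p - X := by
  rw [X_mul_derivative_polylogPoly, polylogPoly]
  have h : ∑ k ∈ Finset.Icc 1 (p - 1), C ((k : ZMod p)⁻¹ ^ 0) * X ^ k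
      = X * ∑ k ∈ Finset.range (p - 1), (X : (ZMod p)[X]) ^ k := by
    have hI : Finset.Icc 1 (p - 1) = Finset.Ico (0 + 1) (p - 1 + 1) := by
      ext; simp only [Finset.mem_Icc, Finset.mem_Ico]; omega
    rw [Finset.mul_sum, Finset.range_eq_Ico, hI,
      ← Finset.sum_Ico_add' (fun k : ℕ => C ((k : ZMod p)⁻¹ ^ 0) * (X : (ZMod p)[X]) ^ k)]
    simp [pow_succ']
  rw [h]
  have h2 := geom_sum_mul (X : (ZMod p)[X]) (p - 1)
  have h3 : (X : (ZMod p)[X]) ^ p = X ^ (p - 1) * X := by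
    rw [← pow_succ, Nat.sub_add_cancel hp.out.one_le]
  rw [h3]
  linear_combination X * h2

/-- In characteristic `p` a zero derivative makes `f` a polynomial in `X^p`. The degree bound leaves
`a + b X^p`, and the two values kill `a` and `b`. This replaces integration in the proofs of
identities below. -/
theorem eq_zero_of_derivative_eq_zero {f : (ZMod p)[X]} (hf : derivative f = 0)
    (hdeg : f.natDegree < 2 * p) (h0 : f.eval 0 = 0) (h1 : f.eval 1 = 0) : f = 0 := by
  have hp0 : p ≠ 0 := hp.out.ne_zero
  have h := expand_contract p hf hp0
  set g := contract p f
  have hg0 : g.eval 0 = 0 := by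
    rw [← h, expand_eval, zero_pow hp0] at h0; exact h0
  have hg1 : g.eval 1 = 0 := by
    rw [← h, expand_eval, one_pow] at h1; exact h1
  have hgdeg : g.natDegree ≤ 1 := by
    rw [← h, natDegree_expand] at hdeg
    have := lt_of_mul_lt_mul_right hdeg (Nat.zero_le p)
    omega
  have hg := eq_X_add_C_of_natDegree_le_one hgdeg
  have hg2 : g = 0 := by
    rw [hg] at hg0 hg1
    simp only [eval_add, eval_mul, eval_C, eval_X, mul_zero, zero_add, mul_one] at hg0 hg1
    rw [hg0, add_zero] at hg1
    rw [hg, hg0, hg1]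
    simp
  rw [← h, hg2, map_zero]

/-- The integral lift `(1 - X ^ p - (1 - X) ^ p) / p` of the finite logarithm. -/
theorem exists_lift_polylogPoly_one (hp3 : 3 < p) : ∃ Q : ℤ[X],
    1 - X ^ p - (1 - X) ^ p = C (p : ℤ) * Q ∧ Q.map (Int.castRingHom (ZMod p)) = polylogPoly p 1 := by
  have hodd : Odd p := hp.out.odd_of_ne_two (by omega)
  have hpC : (C (p : ℤ) : ℤ[X]) ≠ 0 := by
    rw [Ne, C_eq_zero]; exact_mod_cast hp.out.ne_zero
  have hdvd : C (p : ℤ) ∣ (1 - X ^ p - (1 - X) ^ p : ℤ[X]) := by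
    rw [C_dvd_iff_dvd_coeff]
    intro i
    rw [← ZMod.intCast_zmod_eq_zero_iff_dvd]
    have : ((1 - X ^ p - (1 - X) ^ p : ℤ[X]).map (Int.castRingHom (ZMod p))).coeff i = 0 := by
      simp [sub_pow_char]
    rwa [coeff_map] at this
  obtain ⟨Q, hQ⟩ := hdvd
  refine ⟨Q, hQ, ?_⟩
  rw [← sub_eq_zero]
  -- Differentiating the `p`-th powers produces a factor `p`, which cancels the one in front of `Q`.
  have hQ' : derivative Q = (1 - X) ^ (p - 1) - X ^ (p - 1) := by
    have h := congrArg derivative hQ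
    simp only [derivative_sub, derivative_one, derivative_pow, derivative_X,
      derivative_mul, derivative_C] at h
    apply mul_left_cancel₀ hpC
    simp only [map_natCast] at h ⊢
    linear_combination -h
  have hev (a : ℤ) : 1 - a ^ p - (1 - a) ^ p = p * Q.eval a := by
    have h := congrArg (eval a) hQ
    simpa using h
  have hp0 : (p : ℤ) ≠ 0 := by exact_mod_cast hp.out.ne_zero
  have hQ0 : Q.eval 0 = 0 := by
    have := hev 0
    simpa [hp.out.ne_zero] using this
  have hQ1 : Q.eval 1 = 0 := by
    have := hev 1
    simpa [hp.out.ne_zero] using this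
  have hQdeg : Q.natDegree ≤ p := by
    rw [← natDegree_C_mul (show (p : ℤ) ≠ 0 from hp0) (p := Q), ← hQ]
    compute_degree
  -- Modulo `p`, the derivatives of `Q` and `L_1` both become `X^p - X` after multiplication by `X(X
  -- - 1)`.
  apply eq_zero_of_derivative_eq_zero
  · have hX : (X : (ZMod p)[X]) ≠ 0 := X_ne_zero
    have hX1 : (X - 1 : (ZMod p)[X]) ≠ 0 := by simpa using X_sub_C_ne_zero (1 : ZMod p)
    apply mul_left_cancel₀ hX
    apply mul_left_cancel₀ hX1
    have h := derivative_polylogPoly_one (p := p)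
    rw [derivative_sub, derivative_map, hQ']
    simp only [Polynomial.map_sub, Polynomial.map_pow, Polynomial.map_one, map_X]
    have h3 : (X : (ZMod p)[X]) ^ p = X ^ (p - 1) * X := by
      rw [← pow_succ, Nat.sub_add_cancel hp.out.one_le]
    have h4 : (1 - X : (ZMod p)[X]) ^ p = (1 - X) ^ (p - 1) * (1 - X) := by
      rw [← pow_succ, Nat.sub_add_cancel hp.out.one_le]
    have h5 : (1 - X : (ZMod p)[X]) ^ p = 1 - X ^ p := by rw [sub_pow_char, one_pow]
    linear_combination -h + (X - 1) * h3 + X * h4 - X * h5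
  · refine (natDegree_sub_le _ _).trans_lt ?_
    have h1 := natDegree_polylogPoly_le p 1
    have h2 := (natDegree_map_le (f := Int.castRingHom (ZMod p)) (p := Q)).trans hQdeg
    have := hp.out.pos
    omega
  · have := polylogPoly_eval_zero (p := p) 1
    rw [eval_sub, this, sub_zero]
    have h := eval_map_apply (Int.castRingHom (ZMod p)) (p := Q) 0
    rw [hQ0] at h
    simpa using h
  · have := polylogPoly_eval_one (p := p) (d := 1) (by omega) (by omega)
    rw [eval_sub, this, sub_zero]
    have h := eval_map_apply (Int.castRingHom (ZMod p)) (p := Q) 1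
    rw [hQ1] at h
    simpa using h

/-- The lift `(1 - X^p - (1 - X)^p)/p` is visibly symmetric under `X ↦ 1 - X`. -/
theorem polylogPoly_one_comp_one_sub_X (hp3 : 3 < p) :
    (polylogPoly p 1).comp (1 - X) = polylogPoly p 1 := by
  obtain ⟨Q, hQ, hQL⟩ := exists_lift_polylogPoly_one hp3
  have hpC : (C (p : ℤ) : ℤ[X]) ≠ 0 := by
    rw [Ne, C_eq_zero]; exact_mod_cast hp.out.ne_zero
  have h : Q.comp (1 - X) = Q := by
    apply mul_left_cancel₀ hpC
    rw [← hQ]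
    have h := congrArg (fun f => f.comp (1 - X)) hQ
    simp only [sub_comp, one_comp, pow_comp, X_comp, mul_comp, C_comp] at h
    rw [← h]
    ring
  rw [← hQL]
  conv_rhs => rw [← h]
  rw [Polynomial.map_comp]
  simp

/-- Granville's congruence for the square of the finite logarithm. -/
theorem polylogPoly_one_sq (hp3 : 3 < p) :
    polylogPoly p 1 ^ 2 + 2 * X ^ p * polylogPoly p 2
      + 2 * (1 - X ^ p) * (polylogPoly p 2).comp (1 - X) = 0 := by
  have hX : (X : (ZMod p)[X]) ≠ 0 := X_ne_zero
  have hX1 : (X - 1 : (ZMod p)[X]) ≠ 0 := by simpa using X_sub_C_ne_zero (1 : ZMod p)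
  have hG := X_mul_derivative_polylogPoly (p := p) 1
  have hL := derivative_polylogPoly_one (p := p)
  have hG' := congrArg (fun f => f.comp (1 - X)) hG
  simp only [mul_comp, X_comp, polylogPoly_one_comp_one_sub_X hp3, one_add_one_eq_two] at hG hG'
  -- `X^p` has derivative zero, while `X L_2' = L_1` and its reflection express everything through
  -- `L_1`. After multiplication by `X(X - 1)` the derivative is `2 L_1` times a polynomial that
  -- cancels identically.
  apply eq_zero_of_derivative_eq_zero
  · apply mul_left_cancel₀ hX
    apply mul_left_cancel₀ hX1
    simp only [derivative_add, derivative_mul, derivative_pow, derivative_comp, derivative_sub,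
      derivative_one, derivative_X, derivative_ofNat, CharP.cast_eq_zero, map_natCast,
      map_zero]
    push_cast
    simp only [pow_one]
    linear_combination 2 * polylogPoly p 1 * hL + 2 * X ^ p * (X - 1) * hG
      + 2 * X * (1 - X ^ p) * hG'
  · have h1 := natDegree_polylogPoly_le p 1
    have h2 := natDegree_polylogPoly_le p 2
    have hc : ((polylogPoly p 2).comp (1 - X)).natDegree ≤ p - 1 := by
      refine natDegree_comp_le.trans ?_
      have : (1 - X : (ZMod p)[X]).natDegree ≤ 1 := by compute_degree
      nlinarith
    have e1 : (polylogPoly p 1 ^ 2).natDegree ≤ 2 * p - 1 :=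
      natDegree_pow_le.trans (by omega)
    have e2 : (2 * X ^ p * polylogPoly p 2).natDegree ≤ 2 * p - 1 := by
      have : (2 * X ^ p : (ZMod p)[X]).natDegree ≤ p := by compute_degree
      exact natDegree_mul_le.trans (by omega)
    have e3 : (2 * (1 - X ^ p) * (polylogPoly p 2).comp (1 - X)).natDegree ≤ 2 * p - 1 := by
      have : (2 * (1 - X ^ p) : (ZMod p)[X]).natDegree ≤ p := by compute_degree
      exact natDegree_mul_le.trans (by omega)
    have := natDegree_add_le_of_degree_le (natDegree_add_le_of_degree_le e1 e2) e3
    omega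
  · simp [polylogPoly_eval_zero, polylogPoly_eval_one (p := p) (d := 2) (by omega) (by omega),
      hp.out.ne_zero]
  · simp [polylogPoly_eval_zero, polylogPoly_eval_one (p := p) (d := 2) (by omega) (by omega),
      polylogPoly_eval_one (p := p) (d := 1) (by omega) (by omega)]

end PolynomialIdentities

/-! ### Evaluation at cube and sixth roots of unity in characteristic `p` -/

section CharPAlgebra

open Polynomial

variable {p : ℕ} [hp : Fact p.Prime] {R : Type*} [CommRing R] [Algebra (ZMod p) R]

theorem aeval_polylogPoly (d : ℕ) (x : R) : aeval x (polylogPoly p d) =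
    ∑ k ∈ Finset.Icc 1 (p - 1), algebraMap (ZMod p) R ((k : ZMod p)⁻¹ ^ d) * x ^ k := by
  simp [polylogPoly]

/-- Inversion: the substitution `k ↦ p - k` preserves `1/k^2` modulo `p` and turns `x^p y^k` into
`x^(p-k)`. -/
theorem pow_mul_aeval_polylogPoly_two {x y : R} (hxy : x * y = 1) :
    x ^ p * aeval y (polylogPoly p 2) = aeval x (polylogPoly p 2) := by
  rw [aeval_polylogPoly, aeval_polylogPoly, Finset.mul_sum]
  refine Finset.sum_nbij' (fun k => p - k) (fun k => p - k) ?_ ?_ ?_ ?_ ?_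
  · intro k hk; rw [Finset.mem_Icc] at hk ⊢; omega
  · intro k hk; rw [Finset.mem_Icc] at hk ⊢; omega
  · intro k hk; rw [Finset.mem_Icc] at hk; omega
  · intro k hk; rw [Finset.mem_Icc] at hk; omega
  · intro k hk
    rw [Finset.mem_Icc] at hk
    have hx : x ^ p = x ^ (p - k) * x ^ k := by rw [← pow_add]; congr 1; omega
    have hc : ((p - k : ℕ) : ZMod p) = -(k : ZMod p) := by
      rw [Nat.cast_sub (by omega), CharP.cast_eq_zero, zero_sub]
    have h1 : x ^ k * y ^ k = 1 := by rw [← mul_pow, hxy, one_pow]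
    rw [hc, inv_neg, neg_sq, hx]
    linear_combination (algebraMap (ZMod p) R ((k : ZMod p)⁻¹ ^ 2)) * x ^ (p - k) * h1

theorem one_add_pow_add_pow_of_cube_root {ζ : R} (hζ : ζ ^ 2 + ζ + 1 = 0) (k : ℕ) :
    1 + ζ ^ k + (ζ ^ 2) ^ k = if 3 ∣ k then 3 else 0 := by
  have h3 : ζ ^ 3 = 1 := by linear_combination (ζ - 1) * hζ
  have hk := Nat.div_add_mod k 3
  have hpow : ζ ^ k = ζ ^ (k % 3) := by
    conv_lhs => rw [← hk, pow_add, pow_mul, h3, one_pow, one_mul]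
  rw [← pow_mul, mul_comm 2 k, pow_mul, hpow]
  have hlt := Nat.mod_lt k (show 0 < 3 by norm_num)
  split_ifs with h
  · rw [Nat.mod_eq_zero_of_dvd h]; norm_num
  · have : k % 3 = 1 ∨ k % 3 = 2 := by omega
    rcases this with h' | h' <;> rw [h']
    · linear_combination hζ
    · linear_combination hζ + ζ * h3

theorem sum_dvd_three_inv_sq (hp3 : 3 < p) :
    9 * ∑ k ∈ Finset.Icc 1 (p - 1) with 3 ∣ k, (k : ZMod p)⁻¹ ^ 2 =
      ∑ j ∈ Finset.Icc 1 (p / 3), (j : ZMod p)⁻¹ ^ 2 := by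
  have h3 : (3 : ZMod p) ≠ 0 := by
    have := natCast_ne_zero_of_mem_Icc (p := p) (k := 3) (Finset.mem_Icc.2 ⟨by omega, by omega⟩)
    simpa using this
  rw [Finset.mul_sum]
  symm
  refine Finset.sum_nbij' (fun j => 3 * j) (fun k => k / 3) ?_ ?_ ?_ ?_ ?_
  · intro j hj
    rw [Finset.mem_Icc] at hj
    rw [Finset.mem_filter, Finset.mem_Icc]
    have hne : 3 * j ≠ p := by
      intro h
      have := (Nat.prime_dvd_prime_iff_eq Nat.prime_three hp.out).1 ⟨j, h.symm⟩
      omega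
    refine ⟨by omega, dvd_mul_right _ _⟩
  · intro k hk
    rw [Finset.mem_filter, Finset.mem_Icc] at hk
    rw [Finset.mem_Icc]
    omega
  · intro j hj; simp
  · intro k hk
    rw [Finset.mem_filter] at hk
    exact Nat.mul_div_cancel' hk.2
  · intro j hj
    rw [Nat.cast_mul, mul_inv, mul_pow]
    push_cast
    field_simp
    norm_num

/-- Summing `L_2` over `1, ζ, ζ^2` isolates the indices divisible by 3. Here `L_2(1) = 0`, and
inversion gives `L_2(ζ^2) = ζ^(2p) L_2(ζ)`, so the sum is `(1 + ζ^(2p)) L_2(ζ) = -ζ^p L_2(ζ)`. -/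
theorem three_mul_aeval_polylogPoly_two [CharP R p] (hp3 : 3 < p) {ζ : R}
    (hζ : ζ ^ 2 + ζ + 1 = 0) :
    3 * aeval ζ (polylogPoly p 2) = -(ζ ^ p) ^ 2 *
      algebraMap (ZMod p) R (∑ j ∈ Finset.Icc 1 (p / 3), (j : ZMod p)⁻¹ ^ 2) := by
  have h3 : ζ ^ 3 = 1 := by linear_combination (ζ - 1) * hζ
  have hz := pow_mul_aeval_polylogPoly_two (p := p) (x := ζ) (y := ζ ^ 2)
    (by linear_combination h3)
  have h1 : aeval (1 : R) (polylogPoly p 2) = 0 := by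
    have := aeval_algebraMap_apply_eq_algebraMap_eval (A := R) (1 : ZMod p) (polylogPoly p 2)
    rw [polylogPoly_eval_one (by omega) (by omega), map_one, map_zero] at this
    exact this
  have hsum : aeval (1 : R) (polylogPoly p 2) + aeval ζ (polylogPoly p 2)
      + aeval (ζ ^ 2) (polylogPoly p 2) = 3 * algebraMap (ZMod p) R
        (∑ k ∈ Finset.Icc 1 (p - 1) with 3 ∣ k, (k : ZMod p)⁻¹ ^ 2) := by
    simp only [aeval_polylogPoly]
    rw [← Finset.sum_add_distrib, ← Finset.sum_add_distrib, map_sum, Finset.mul_sum,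
      Finset.sum_filter]
    refine Finset.sum_congr rfl fun k _ => ?_
    have h := one_add_pow_add_pow_of_cube_root hζ k
    rw [one_pow, ← mul_add, ← mul_add, h]
    split_ifs <;> ring
  have hF : (ζ ^ p) ^ 2 + ζ ^ p + 1 = 0 := by
    have := congrArg (fun x => x ^ p) hζ
    simp only [add_pow_char, one_pow, zero_pow hp.out.ne_zero] at this
    rw [← this, pow_right_comm]
  have hF3 : (ζ ^ p) ^ 3 = 1 := by rw [pow_right_comm, h3, one_pow]
  rw [← sum_dvd_three_inv_sq hp3, map_mul, map_ofNat]
  rw [h1] at hsum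
  linear_combination -3 * (ζ ^ p) ^ 2 * hsum + 3 * ζ ^ p * hz - 3 * aeval ζ (polylogPoly p 2) * hF3
    + 3 * ζ ^ p * aeval ζ (polylogPoly p 2) * hF

/-- The residue ring used later is not known to be a domain, but integers prime to `p` are units in
every `ZMod p`-algebra. -/
theorem natCast_mul_left_cancel {n : ℕ} (hn : ¬ p ∣ n) {a b : R}
    (h : (n : R) * a = (n : R) * b) : a = b := by
  have hn0 : (n : ZMod p) ≠ 0 := by rwa [Ne, ZMod.natCast_eq_zero_iff]
  have hu : algebraMap (ZMod p) R (n : ZMod p)⁻¹ * (n : R) = 1 := by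
    rw [← map_natCast (algebraMap (ZMod p) R) n, ← map_mul, inv_mul_cancel₀ hn0, map_one]
  calc a = algebraMap (ZMod p) R (n : ZMod p)⁻¹ * (n : R) * a := by rw [hu, one_mul]
    _ = algebraMap (ZMod p) R (n : ZMod p)⁻¹ * (n : R) * b := by rw [mul_assoc, h, mul_assoc]
    _ = b := by rw [hu, one_mul]

theorem not_dvd_two_pow_mul_three_pow (hp3 : 3 < p) (a b : ℕ) : ¬ p ∣ 2 ^ a * 3 ^ b := by
  intro h
  rcases hp.out.dvd_mul.1 h with h | h
  · have := Nat.le_of_dvd (by norm_num) (hp.out.dvd_of_dvd_pow h); omega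
  · have := Nat.le_of_dvd (by norm_num) (hp.out.dvd_of_dvd_pow h); omega

theorem pow_six_eq_one_of_sq {A : Type*} [CommRing A] {w : A} (hw : w ^ 2 = w - 1) :
    w ^ 6 = 1 := by
  linear_combination (w ^ 4 + w ^ 3 - w - 1) * hw

/-- Powers of a primitive sixth root of unity with exponent prime to `6`. -/
theorem pow_prime_of_sq {A : Type*} [CommRing A] {w : A} (hw : w ^ 2 = w - 1) (hp3 : 3 < p) :
    (legendreSym 3 (p : ℤ) = 1 ∧ w ^ p = w) ∨ (legendreSym 3 (p : ℤ) = -1 ∧ w ^ p = 1 - w) := by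
  have h6 := pow_six_eq_one_of_sq hw
  have h2 : ¬ 2 ∣ p := fun h => by
    have := (Nat.prime_dvd_prime_iff_eq Nat.prime_two hp.out).1 h; omega
  have h3 : ¬ 3 ∣ p := fun h => by
    have := (Nat.prime_dvd_prime_iff_eq Nat.prime_three hp.out).1 h; omega
  have hdm := Nat.div_add_mod p 6
  have hpow : w ^ p = w ^ (p % 6) := by
    conv_lhs => rw [← hdm, pow_add, pow_mul, h6, one_pow, one_mul]
  have hmod : p % 6 = 1 ∨ p % 6 = 5 := by omega
  rcases hmod with h | h
  · left
    refine ⟨?_, by rw [hpow, h, pow_one]⟩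
    rw [legendreSym.mod, show (p : ℤ) % ((3 : ℕ) : ℤ) = 1 by omega]
    exact legendreSym.at_one 3
  · right
    refine ⟨?_, ?_⟩
    · rw [legendreSym.mod, show (p : ℤ) % ((3 : ℕ) : ℤ) = 2 by omega]
      decide
    · rw [hpow, h]
      linear_combination (w ^ 3 + w ^ 2 - 1) * hw

/-- Since `(1 + w)^2 = 3w`, `p = 2m + 1` gives `(1 + w)^p = 3^m (1 + w) w^m`, which is `±3^m (1 +
w^p)`. Only `u^2` matters later, so the sign is left unspecified. -/
theorem exists_one_add_pow_prime {A : Type*} [CommRing A] {w : A} (hw : w ^ 2 = w - 1)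
    (hp3 : 3 < p) : ∃ u : ℤ, u ^ 2 = 3 ^ (p - 1) ∧ (1 + w) ^ p = u * (1 + w ^ p) := by
  have h6 := pow_six_eq_one_of_sq hw
  have h3' : w ^ 3 = -1 := by linear_combination (w + 1) * hw
  have h2 : ¬ 2 ∣ p := fun h => by
    have := (Nat.prime_dvd_prime_iff_eq Nat.prime_two hp.out).1 h; omega
  have h3 : ¬ 3 ∣ p := fun h => by
    have := (Nat.prime_dvd_prime_iff_eq Nat.prime_three hp.out).1 h; omega
  obtain ⟨m, hm⟩ : ∃ m, p = 2 * m + 1 := ⟨p / 2, by omega⟩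
  have key : (1 + w) ^ p = 3 ^ m * ((1 + w) * w ^ m) := by
    rw [hm, pow_succ, pow_mul, show (1 + w) ^ 2 = 3 * w by linear_combination hw, mul_pow]
    ring
  have hu : (3 ^ m : ℤ) ^ 2 = 3 ^ (p - 1) := by
    rw [← pow_mul, hm]; congr 1; omega
  have hdm := Nat.div_add_mod m 6
  have hpm : w ^ m = w ^ (m % 6) := by
    conv_lhs => rw [← hdm, pow_add, pow_mul, h6, one_pow, one_mul]
  have hpp : w ^ p = (w ^ (m % 6)) ^ 2 * w := by
    rw [hm, pow_succ, mul_comm 2 m, pow_mul, hpm]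
  -- The residues 1 and 4 would make `p = 2m + 1` divisible by 3.
  have hmod : m % 6 = 0 ∨ m % 6 = 2 ∨ m % 6 = 3 ∨ m % 6 = 5 := by omega
  rw [key, hpp, hpm]
  rcases hmod with h | h | h | h <;> rw [h]
  · exact ⟨3 ^ m, hu, by push_cast; ring⟩
  · refine ⟨-3 ^ m, by rw [neg_sq]; exact hu, ?_⟩
    push_cast
    linear_combination 3 ^ m * (w ^ 2 + 1) * h3'
  · refine ⟨-3 ^ m, by rw [neg_sq]; exact hu, ?_⟩
    push_cast
    linear_combination 3 ^ m * (w ^ 4 + 1) * h3'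
  · refine ⟨3 ^ m, hu, ?_⟩
    push_cast
    linear_combination 3 ^ m * (1 - w ^ 5) * h6

/-- The two evaluations in an algebra over `ZMod p`, with denominators cleared. -/
theorem aeval_polylogPoly_two_one_add [CharP R p] (hp3 : 3 < p) {w q s β : R}
    (hw : w ^ 2 = w - 1)
    (hL : 3 * aeval (1 + w) (polylogPoly p 1) = -(1 + w ^ p) * s) (hs : 9 * q = 6 * s)
    (hβ : 2 * algebraMap (ZMod p) R (∑ j ∈ Finset.Icc 1 (p / 3), (j : ZMod p)⁻¹ ^ 2) =
      (legendreSym 3 (p : ℤ) : R) * β) :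
    144 * aeval (1 + w) (polylogPoly p 2) =
      -9 * q ^ 2 * (3 + (2 * w - 1) * (legendreSym 3 (p : ℤ) : R)) +
        4 * (3 * (legendreSym 3 (p : ℤ) : R) - (2 * w - 1)) * β := by
  have hodd : Odd p := hp.out.odd_of_ne_two (by omega)
  have hG := congrArg (aeval (1 + w)) (polylogPoly_one_sq (p := p) hp3)
  simp only [map_add, map_mul, map_pow, map_sub, map_one, map_ofNat, aeval_X, aeval_comp,
    map_zero] at hG
  rw [add_pow_char, one_pow, show 1 - (1 + w) = -w by ring] at hG
  have hζ := three_mul_aeval_polylogPoly_two (p := p) hp3 (ζ := -w) (by linear_combination hw)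
  rw [hodd.neg_pow] at hζ
  set G := aeval (1 + w) (polylogPoly p 2)
  set L := aeval (1 + w) (polylogPoly p 1)
  set Z := aeval (-w) (polylogPoly p 2)
  set h := algebraMap (ZMod p) R (∑ j ∈ Finset.Icc 1 (p / 3), (j : ZMod p)⁻¹ ^ 2)
  set χ : R := (legendreSym 3 (p : ℤ) : R) with hχ
  set v := w ^ p with hv'
  -- `v = w^p` is `w` or its conjugate `1 - w` according to `χ`. Since `2w - 1` plays the role of
  -- `±i√3`, it changes by the sign `χ`.
  have hv : v ^ 2 = v - 1 ∧ 2 * w - 1 = χ * (2 * v - 1) ∧ χ ^ 2 = 1 := by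
    rcases pow_prime_of_sq (p := p) hw hp3 with ⟨h1, h2⟩ | ⟨h1, h2⟩
    · rw [hv', h2, hχ, h1]; push_cast; exact ⟨hw, by ring, by ring⟩
    · rw [hv', h2, hχ, h1]; push_cast; exact ⟨by linear_combination hw, by ring, by ring⟩
  obtain ⟨hv, hwv, hχ2⟩ := hv
  clear_value v
  have hLq : 4 * L ^ 2 = (1 + v) ^ 2 * q ^ 2 := by
    apply natCast_mul_left_cancel (n := 2 ^ 0 * 3 ^ 4) (not_dvd_two_pow_mul_three_pow hp3 0 4)
    push_cast
    linear_combination 36 * (3 * L - (1 + v) * s) * hL - (1 + v) ^ 2 * (9 * q + 6 * s) * hs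
  -- Granville's identity at `1 + w` with `L_1` and `L_2(-w)` substituted, using `v^3 = -1`.
  have h12 : 3 * (1 + v) ^ 2 * q ^ 2 + 24 * (1 + v) * G - 4 * χ * β = 0 := by
    linear_combination 12 * hG - 3 * hLq + 8 * v * hζ + 4 * hβ - 8 * h * (v + 1) * hv
  -- The factor `1 + v` is removed by `(1 + v)(2 - v) = 3`.
  have h72 : 72 * G = -9 * (1 + v) * q ^ 2 + 4 * χ * (2 - v) * β := by
    linear_combination (2 - v) * h12 + (3 * (1 + v) * q ^ 2 + 24 * G) * hv
  rw [hwv]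
  linear_combination 2 * h72 + 9 * q ^ 2 * (2 * v - 1) * hχ2

/-- As `(1 + w)(2 - w) = 3`, `y` is inverse to `1 + (1 - w)`, so inversion reduces the claim to the
first evaluation at the conjugate root, with `y^p = (1 + w^p)/3`. -/
theorem aeval_polylogPoly_two_one_add_div_three [CharP R p] (hp3 : 3 < p) {w y q β : R}
    (hw : w ^ 2 = w - 1) (hy : 3 * y = 1 + w)
    (hG : 144 * aeval (1 + (1 - w)) (polylogPoly p 2) =
      -9 * q ^ 2 * (3 + (2 * (1 - w) - 1) * (legendreSym 3 (p : ℤ) : R)) +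
        4 * (3 * (legendreSym 3 (p : ℤ) : R) - (2 * (1 - w) - 1)) * β) :
    72 * aeval y (polylogPoly p 2) =
      -9 * q ^ 2 + 2 * ((legendreSym 3 (p : ℤ) : R) + (2 * w - 1)) * β := by
  have hy1 : y * (1 + (1 - w)) = 1 := by
    apply natCast_mul_left_cancel (n := 2 ^ 0 * 3 ^ 1) (not_dvd_two_pow_mul_three_pow hp3 0 1)
    push_cast
    linear_combination (2 - w) * hy - hw
  have hinv := pow_mul_aeval_polylogPoly_two (p := p) hy1
  have hyp : 3 * y ^ p = 1 + w ^ p := by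
    have h := congrArg (fun x => x ^ p) hy
    have h3 : (3 : R) ^ p = 3 := by
      rw [← map_ofNat (algebraMap (ZMod p) R) 3, ← map_pow, ZMod.pow_card]
    simpa only [mul_pow, add_pow_char, one_pow, h3] using h
  set G := aeval (1 + (1 - w)) (polylogPoly p 2)
  set v := w ^ p with hv'
  set χ : R := (legendreSym 3 (p : ℤ) : R) with hχ
  have hv : v ^ 2 = v - 1 ∧ 2 * w - 1 = χ * (2 * v - 1) ∧ χ ^ 2 = 1 := by
    rcases pow_prime_of_sq (p := p) hw hp3 with ⟨h1, h2⟩ | ⟨h1, h2⟩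
    · rw [hv', h2, hχ, h1]; push_cast; exact ⟨hw, by ring, by ring⟩
    · rw [hv', h2, hχ, h1]; push_cast; exact ⟨by linear_combination hw, by ring, by ring⟩
  obtain ⟨hv, hwv, hχ2⟩ := hv
  clear_value v
  rw [show 2 * (1 - w) - 1 = - (2 * w - 1) by ring, hwv] at hG
  rw [hwv]
  apply natCast_mul_left_cancel (n := 2 ^ 1 * 3 ^ 1) (not_dvd_two_pow_mul_three_pow hp3 1 1)
  push_cast
  rw [← hinv]
  linear_combination 144 * G * hyp + (1 + v) * hG + 9 * q ^ 2 * (2 * v - 1) * (v + 1) * hχ2 +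
    (18 * q ^ 2 + 8 * χ * β) * hv

end CharPAlgebra

/-! ### The ring of `p`-integral algebraic numbers and its reduction modulo `p` -/

section PIntegral

open Polynomial

/-- The subring of `p`-integral algebraic numbers. -/
def pIntegralSubring (p : ℕ) [hp : Fact p.Prime] : Subring ℂ where
  carrier := {z | IsPIntegral p z}
  one_mem' := ⟨1, (Nat.prime_iff_prime_int.1 hp.out).not_dvd_one, by simpa using isIntegral_one⟩
  zero_mem' := ⟨1, (Nat.prime_iff_prime_int.1 hp.out).not_dvd_one, by simpa using isIntegral_zero⟩
  mul_mem' := by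
    rintro x y ⟨s, hs, hx⟩ ⟨t, ht, hy⟩
    refine ⟨s * t, (Nat.prime_iff_prime_int.1 hp.out).not_dvd_mul hs ht, ?_⟩
    rw [Int.cast_mul, mul_mul_mul_comm]
    exact hx.mul hy
  add_mem' := by
    rintro x y ⟨s, hs, hx⟩ ⟨t, ht, hy⟩
    refine ⟨s * t, (Nat.prime_iff_prime_int.1 hp.out).not_dvd_mul hs ht, ?_⟩
    have := (hx.mul (isIntegral_algebraMap (x := t))).add (hy.mul (isIntegral_algebraMap (x := s)))
    rw [show ((s * t : ℤ) : ℂ) * (x + y) = s * x * t + t * y * s by push_cast; ring]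
    exact this
  neg_mem' := by
    rintro x ⟨s, hs, hx⟩
    exact ⟨s, hs, by simpa using hx.neg⟩

variable {p : ℕ} [hp : Fact p.Prime]

theorem IsIntegral.mem_pIntegralSubring {z : ℂ} (hz : IsIntegral ℤ z) :
    z ∈ pIntegralSubring p :=
  ⟨1, (Nat.prime_iff_prime_int.1 hp.out).not_dvd_one, by simpa using hz⟩

theorem inv_natCast_mem_pIntegralSubring {n : ℕ} (hn : ¬ p ∣ n) :
    (n : ℂ)⁻¹ ∈ pIntegralSubring p := by
  refine ⟨n, by exact_mod_cast hn, ?_⟩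
  have : (n : ℂ) ≠ 0 := by
    rintro h
    rw [Nat.cast_eq_zero] at h
    exact hn (h ▸ dvd_zero p)
  rw [Int.cast_natCast, mul_inv_cancel₀ this]
  exact isIntegral_one

/-- If `s/p` is integral over `ℤ`, it is an integer, because `ℤ` is integrally closed. This makes
the residue ring nontrivial, hence of characteristic `p`. -/
theorem inv_prime_notMem_pIntegralSubring : (p : ℂ)⁻¹ ∉ pIntegralSubring p := by
  rintro ⟨s, hs, h⟩
  have hp0 : (p : ℚ) ≠ 0 := by exact_mod_cast hp.out.ne_zero
  have h1 : (s : ℂ) * (p : ℂ)⁻¹ = algebraMap ℚ ℂ (s * (p : ℚ)⁻¹) := by simp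
  rw [h1, isIntegral_algebraMap_iff (algebraMap ℚ ℂ).injective,
    IsIntegrallyClosed.isIntegral_iff] at h
  obtain ⟨y, hy⟩ := h
  apply hs
  refine ⟨y, ?_⟩
  have h2 : (s : ℚ) = p * y := by
    rw [algebraMap_int_eq, eq_intCast] at hy
    rw [hy]
    field_simp
  exact_mod_cast h2

/-- The residue ring of the `p`-integral algebraic numbers modulo `p`. -/
abbrev pResidueRing (p : ℕ) [Fact p.Prime] : Type :=
  pIntegralSubring p ⧸ Ideal.span {(p : pIntegralSubring p)}

/-- Reduction modulo `p`. -/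
abbrev modP (p : ℕ) [Fact p.Prime] : pIntegralSubring p →+* pResidueRing p :=
  Ideal.Quotient.mk _

theorem modP_eq_zero_iff {x : pIntegralSubring p} :
    modP p x = 0 ↔ ∃ z : pIntegralSubring p, x = p * z := by
  rw [Ideal.Quotient.eq_zero_iff_mem, Ideal.mem_span_singleton]
  exact Iff.rfl

instance nontrivial_pResidueRing : Nontrivial (pResidueRing p) := by
  refine ⟨⟨1, 0, fun h => ?_⟩⟩
  rw [← map_one (modP p), modP_eq_zero_iff] at h
  obtain ⟨z, hz⟩ := h
  apply inv_prime_notMem_pIntegralSubring (p := p)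
  have h2 := congrArg (Subtype.val) hz
  push_cast at h2
  rw [inv_eq_of_mul_eq_one_right h2.symm]
  exact z.2

instance charP_pResidueRing : CharP (pResidueRing p) p := by
  rw [CharP.charP_iff_prime_eq_zero hp.out, ← map_natCast (modP p), modP_eq_zero_iff]
  exact ⟨1, by rw [mul_one]⟩

noncomputable instance algebra_pResidueRing : Algebra (ZMod p) (pResidueRing p) :=
  ZMod.algebra _ p

/-- The inverse of a natural number among the `p`-integral numbers, `0` for multiples of `p`. -/
noncomputable def pIntegralInv (p : ℕ) [Fact p.Prime] (n : ℕ) : pIntegralSubring p :=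
  if h : ¬ p ∣ n then ⟨(n : ℂ)⁻¹, inv_natCast_mem_pIntegralSubring h⟩ else 0

theorem coe_pIntegralInv {n : ℕ} (hn : ¬ p ∣ n) : (pIntegralInv p n : ℂ) = (n : ℂ)⁻¹ := by
  rw [pIntegralInv, dif_pos hn]

theorem natCast_mul_pIntegralInv {n : ℕ} (hn : ¬ p ∣ n) : n * pIntegralInv p n = 1 := by
  apply Subtype.ext
  have : (n : ℂ) ≠ 0 := by
    rintro h
    rw [Nat.cast_eq_zero] at h
    exact hn (h ▸ dvd_zero p)
  push_cast
  rw [coe_pIntegralInv hn, mul_inv_cancel₀ this]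

theorem modP_pIntegralInv {n : ℕ} (hn : ¬ p ∣ n) :
    modP p (pIntegralInv p n) = algebraMap (ZMod p) _ (n : ZMod p)⁻¹ := by
  have hn0 : (n : ZMod p) ≠ 0 := by rwa [Ne, ZMod.natCast_eq_zero_iff]
  apply natCast_mul_left_cancel hn
  rw [← map_natCast (modP p), ← map_mul, natCast_mul_pIntegralInv hn, map_one, map_natCast,
    ← map_natCast (algebraMap (ZMod p) (pResidueRing p)), ← map_mul, mul_inv_cancel₀ hn0, map_one]

theorem exists_finitePolylog_lift (d : ℕ) (x : pIntegralSubring p) :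
    ∃ g : pIntegralSubring p, (g : ℂ) = finitePolylog p d x ∧
      modP p g = aeval (modP p x) (polylogPoly p d) := by
  have hnd : ∀ k ∈ Finset.Icc 1 (p - 1), ¬ p ∣ k := fun k hk h => by
    rw [Finset.mem_Icc] at hk
    have := Nat.le_of_dvd (by omega) h
    omega
  refine ⟨∑ k ∈ Finset.Icc 1 (p - 1), pIntegralInv p k ^ d * x ^ k, ?_, ?_⟩
  · rw [finitePolylog]
    push_cast
    refine Finset.sum_congr rfl fun k hk => ?_
    rw [coe_pIntegralInv (hnd k hk), inv_pow, div_eq_mul_inv, mul_comm]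
  · rw [aeval_polylogPoly, map_sum]
    refine Finset.sum_congr rfl fun k hk => ?_
    rw [map_mul, map_pow, map_pow, modP_pIntegralInv (hnd k hk), map_pow]

theorem congrModP_of_natCast_mul_modP_eq {n : ℕ} (hn : ¬ p ∣ n) {x y : pIntegralSubring p}
    (h : (n : pResidueRing p) * modP p x = n * modP p y) : CongrModP p x y := by
  refine ⟨x.2, y.2, ?_⟩
  have h1 := natCast_mul_left_cancel hn h
  rw [← sub_eq_zero, ← map_sub, modP_eq_zero_iff] at h1
  obtain ⟨z, hz⟩ := h1
  exact ⟨z, z.2, by exact_mod_cast congrArg Subtype.val hz⟩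

/-! ### Bernoulli numbers modulo `p` -/

theorem bernoulli_mem_pIntegralSubring (n : ℕ) (hn : n + 1 < p) :
    ((_root_.bernoulli n : ℚ) : ℂ) ∈ pIntegralSubring p := by
  induction n using Nat.strong_induction_on with
  | _ n ih =>
    rcases Nat.eq_zero_or_pos n with rfl | hpos
    · simp
    have h := _root_.sum_bernoulli (n + 1)
    rw [if_neg (by omega), Finset.sum_range_succ, Nat.choose_succ_self_right] at h
    -- Solving the recurrence for the last Bernoulli number divides only by `n + 1`, which is
    -- smaller than `p`.
    have hnd : ¬ p ∣ n + 1 := fun h => by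
      have := Nat.le_of_dvd (by omega) h
      omega
    have hn0 : ((n + 1 : ℕ) : ℂ) ≠ 0 := by exact_mod_cast Nat.succ_ne_zero n
    have h2 := congrArg (fun r : ℚ => (r : ℂ)) h
    push_cast at h2 hn0
    have h3 : ((_root_.bernoulli n : ℚ) : ℂ) = ((n + 1 : ℕ) : ℂ)⁻¹ *
        -∑ k ∈ Finset.range n, ((n + 1).choose k : ℂ) * ((_root_.bernoulli k : ℚ) : ℂ) := by
      push_cast
      rw [eq_inv_mul_iff_mul_eq₀ hn0]
      linear_combination h2
    rw [h3]
    refine mul_mem (inv_natCast_mem_pIntegralSubring hnd) (neg_mem (sum_mem fun k hk => ?_))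
    rw [Finset.mem_range] at hk
    exact mul_mem (natCast_mem _ _) (ih k hk (by omega))

/-- Having `p`-integral coefficients, the Bernoulli polynomial takes congruent values at congruent
arguments. This allows an integer argument to be replaced by `1/3` or `2/3`. -/
theorem exists_bernoulli_lift {n : ℕ} (hn : n + 1 < p) : ∃ F : (pIntegralSubring p)[X],
    ∀ (x : pIntegralSubring p) (r : ℚ), (x : ℂ) = r →
      ((F.eval x : pIntegralSubring p) : ℂ) = (((Polynomial.bernoulli n).eval r : ℚ) : ℂ) := by
  have hl : (Polynomial.bernoulli n).map (algebraMap ℚ ℂ) ∈ lifts (pIntegralSubring p).subtype := by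
    rw [lifts_iff_coeff_lifts]
    intro i
    rw [coeff_map, coeff_bernoulli]
    split_ifs with h
    · refine ⟨⟨_, mul_mem (bernoulli_mem_pIntegralSubring (p := p) (n - i) (by omega))
        (natCast_mem _ (n.choose i))⟩, ?_⟩
      simp
    · exact ⟨0, by simp⟩
  obtain ⟨F, hF⟩ := (mem_lifts _).1 hl
  refine ⟨F, fun x r hxr => ?_⟩
  have h1 := eval_map_apply (pIntegralSubring p).subtype (p := F) x
  rw [hF] at h1
  have h2 := eval_map_apply (algebraMap ℚ ℂ) (p := Polynomial.bernoulli n) r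
  simp only [Subring.subtype_apply, eq_ratCast] at h1 h2
  rw [← h1, hxr, h2]

theorem exists_bernoulli_third (hp3 : 3 < p) : ∃ b : pIntegralSubring p,
    (b : ℂ) = (((Polynomial.bernoulli (p - 2)).eval (1 / 3 : ℚ) : ℚ) : ℂ) ∧
    2 * algebraMap (ZMod p) (pResidueRing p) (∑ j ∈ Finset.Icc 1 (p / 3), (j : ZMod p)⁻¹ ^ 2) =
      (legendreSym 3 (p : ℤ) : pResidueRing p) * modP p b := by
  obtain ⟨F, hF⟩ := exists_bernoulli_lift (p := p) (n := p - 2) (by omega)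
  have h3nd : ¬ p ∣ 3 := fun h => by have := Nat.le_of_dvd (by norm_num) h; omega
  have h2p : ¬ 2 ∣ p := fun h => by
    have := (Nat.prime_dvd_prime_iff_eq Nat.prime_two hp.out).1 h; omega
  have h3p : ¬ 3 ∣ p := fun h => by
    have := (Nat.prime_dvd_prime_iff_eq Nat.prime_three hp.out).1 h; omega
  have hodd : Odd (p - 2) := by rw [Nat.odd_iff]; omega
  set t := pIntegralInv p 3 with ht'
  have ht : (t : ℂ) = ((1 / 3 : ℚ) : ℂ) := by rw [ht', coe_pIntegralInv h3nd]; norm_num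
  have ht3 : (3 : pResidueRing p) * modP p t = 1 := by
    have := congrArg (modP p) (natCast_mul_pIntegralInv h3nd)
    rw [map_mul, map_natCast, map_one] at this
    exact_mod_cast this
  refine ⟨F.eval t, hF t _ ht, ?_⟩
  -- The added term `j = 0` vanishes because `p - 3 > 0`.
  have hsum : ∑ j ∈ Finset.Icc 1 (p / 3), (j : ZMod p)⁻¹ ^ 2 =
      ∑ j ∈ Finset.range (p / 3 + 1), (j : ZMod p) ^ (p - 3) := by
    rw [Finset.range_eq_Ico, Finset.sum_eq_sum_Ico_succ_bot (by omega), Nat.cast_zero,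
      zero_pow (by omega), zero_add]
    refine Finset.sum_congr (by ext; simp only [Finset.mem_Icc, Finset.mem_Ico]; omega) fun k hk => ?_
    have hk0 : (k : ZMod p) ≠ 0 := natCast_ne_zero_of_mem_Icc (by
      rw [Finset.mem_Ico] at hk; rw [Finset.mem_Icc]; omega)
    have h := ZMod.pow_card_sub_one_eq_one hk0
    rw [show p - 1 = (p - 3) + 2 by omega, pow_add] at h
    rw [inv_pow]
    exact (eq_inv_of_mul_eq_one_left h).symm
  -- Faulhaber's formula; the constant `B_{p-2}` drops out because `p - 2` is odd and greater than
  -- 1.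
  have hN : (F.eval ((p / 3 + 1 : ℕ) : pIntegralSubring p)) =
      (p - 2) * ∑ k ∈ Finset.range (p / 3 + 1), (k : pIntegralSubring p) ^ (p - 3) := by
    apply Subtype.ext
    rw [hF _ ((p / 3 + 1 : ℕ) : ℚ) (by push_cast; rfl)]
    have h := Polynomial.bernoulli_succ_eval (p / 3 + 1) (p - 3)
    rw [show (p - 3).succ = p - 2 by omega, bernoulli_eq_zero_of_odd hodd (by omega), zero_add] at h
    rw [h, Nat.cast_sub (by omega)]
    push_cast
    rw [show ((2 : pIntegralSubring p) : ℂ) = 2 from rfl]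
    ring
  have hNR := congrArg (modP p) hN
  simp only [map_mul, map_sub, map_natCast, map_sum, map_pow, map_ofNat, CharP.cast_eq_zero,
    zero_sub] at hNR
  have hev (x y : pIntegralSubring p) (hxy : modP p x = modP p y) :
      modP p (F.eval x) = modP p (F.eval y) := by
    rw [← eval_map_apply, ← eval_map_apply, hxy]
  have h3N : (p / 3 + 1 : ℕ) * (3 : pResidueRing p) = ((3 * (p / 3 + 1) - p : ℕ) : pResidueRing p) := by
    have h0 : (p : pResidueRing p) = 0 := CharP.cast_eq_zero _ p
    rw [Nat.cast_sub (by omega)]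
    push_cast
    linear_combination h0
  rw [hsum]
  simp only [map_sum, map_pow, map_natCast]
  have hmod : p % 3 = 1 ∨ p % 3 = 2 := by omega
  rcases hmod with h | h
  · have hχ : legendreSym 3 (p : ℤ) = 1 := by
      rw [legendreSym.mod, show (p : ℤ) % ((3 : ℕ) : ℤ) = 1 by omega]
      exact legendreSym.at_one 3
    -- For `p ≡ 1 (mod 3)` the integer `⌊p/3⌋ + 1 = (p + 2)/3` reduces to `2/3`, and reflection in
    -- odd degree changes the sign.
    have h1t : F.eval (1 - t) = - F.eval t := by
      apply Subtype.ext
      rw [hF (1 - t) (1 - 1 / 3) (by push_cast; rw [ht]; push_cast; ring), bernoulli_eval_one_sub,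
        hodd.neg_one_pow]
      push_cast
      rw [hF t _ ht]
      ring
    have hx : modP p ((p / 3 + 1 : ℕ) : pIntegralSubring p) = modP p (1 - t) := by
      apply natCast_mul_left_cancel h3nd
      rw [map_sub, map_one, map_natCast]
      rw [show 3 * (p / 3 + 1) - p = 2 by omega] at h3N
      push_cast at h3N ⊢
      linear_combination h3N + ht3
    rw [hev _ _ hx, h1t, map_neg] at hNR
    rw [hχ]
    push_cast
    linear_combination hNR
  · have hχ : legendreSym 3 (p : ℤ) = -1 := by
      rw [legendreSym.mod, show (p : ℤ) % ((3 : ℕ) : ℤ) = 2 by omega]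
      decide
    -- For `p ≡ 2 (mod 3)` the integer `⌊p/3⌋ + 1 = (p + 1)/3` reduces to `1/3` directly.
    have hx : modP p ((p / 3 + 1 : ℕ) : pIntegralSubring p) = modP p t := by
      apply natCast_mul_left_cancel h3nd
      rw [map_natCast]
      rw [show 3 * (p / 3 + 1) - p = 1 by omega] at h3N
      push_cast at h3N ⊢
      linear_combination h3N - ht3
    rw [hev _ _ hx] at hNR
    rw [hχ]
    push_cast
    linear_combination hNR

end PIntegral

/-! ### The sixth root of unity, the Fermat quotient and the finite logarithm -/

section SixthRoot

open Polynomial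

theorem omegaSix_eq : omegaSix = 1 / 2 + (Real.sqrt 3 : ℂ) / 2 * Complex.I := by
  rw [omegaSix, show 2 * (Real.pi : ℂ) * Complex.I / 6 = ((Real.pi / 3 : ℝ) : ℂ) * Complex.I by
    push_cast; ring, Complex.exp_mul_I, ← Complex.ofReal_cos, ← Complex.ofReal_sin,
    Real.cos_pi_div_three, Real.sin_pi_div_three]
  push_cast
  ring

theorem ofReal_sqrt_three_sq : (Real.sqrt 3 : ℂ) ^ 2 = 3 := by
  rw [← Complex.ofReal_pow, Real.sq_sqrt (by norm_num)]
  norm_num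

theorem omegaSix_sq : omegaSix ^ 2 = omegaSix - 1 := by
  rw [omegaSix_eq]
  linear_combination Complex.I ^ 2 / 4 * ofReal_sqrt_three_sq + 3 / 4 * Complex.I_sq

theorem omegaSix_zpow_eq {ε : ℤ} (hε : ε = 1 ∨ ε = -1) :
    2 * omegaSix ^ ε - 1 = (ε : ℂ) * (Complex.I * (Real.sqrt 3 : ℂ)) := by
  rcases hε with rfl | rfl
  · rw [zpow_one, omegaSix_eq]; push_cast; ring
  · have : omegaSix⁻¹ = 1 - omegaSix :=
      inv_eq_of_mul_eq_one_right (by linear_combination -omegaSix_sq)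
    rw [zpow_neg_one, this, omegaSix_eq]; push_cast; ring

theorem omegaSix_zpow_sq {ε : ℤ} (hε : ε = 1 ∨ ε = -1) :
    (omegaSix ^ ε) ^ 2 = omegaSix ^ ε - 1 := by
  have h := omegaSix_zpow_eq hε
  have hε2 : (ε : ℂ) ^ 2 = 1 := by rcases hε with rfl | rfl <;> norm_num
  linear_combination (2 * omegaSix ^ ε - 1 + (ε : ℂ) * (Complex.I * (Real.sqrt 3 : ℂ))) / 4 * h
    + Complex.I ^ 2 * (Real.sqrt 3 : ℂ) ^ 2 / 4 * hε2 + Complex.I ^ 2 / 4 * ofReal_sqrt_three_sq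
    + 3 / 4 * Complex.I_sq

theorem isIntegral_of_sq_eq_sub_one {w : ℂ} (hw : w ^ 2 = w - 1) : IsIntegral ℤ w := by
  refine ⟨X ^ 2 - X + 1, by monicity!, ?_⟩
  simp only [eval₂_add, eval₂_sub, eval₂_X_pow, eval₂_X, eval₂_one]
  linear_combination hw

variable {p : ℕ} [hp : Fact p.Prime]

theorem exists_fermatQuotient_three (hp3 : 3 < p) :
    ∃ n : ℤ, (3 : ℤ) ^ (p - 1) = 1 + p * n ∧ (n : ℂ) = fermatQuotient p 3 := by
  have h : (p : ℤ) ∣ 3 ^ (p - 1) - 1 := by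
    rw [← ZMod.intCast_zmod_eq_zero_iff_dvd]
    have h3 : ((3 : ℕ) : ZMod p) ≠ 0 :=
      natCast_ne_zero_of_mem_Icc (Finset.mem_Icc.2 ⟨by omega, by omega⟩)
    have := ZMod.pow_card_sub_one_eq_one h3
    push_cast at this ⊢
    rw [this, sub_self]
  obtain ⟨n, hn⟩ := h
  have hp0 : (p : ℂ) ≠ 0 := by exact_mod_cast hp.out.ne_zero
  refine ⟨n, by linear_combination hn, ?_⟩
  rw [fermatQuotient, eq_div_iff hp0]
  have : (3 : ℂ) ^ (p - 1) - 1 = p * n := by exact_mod_cast congrArg (Int.cast (R := ℂ)) hn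
  rw [this, mul_comm]

/-- Here `s` stands for `3(u - 1)/p`, where `(1 + w)^p = u(1 + w^p)`. The first relation is the
lifted finite logarithm at `1 + w`; the second compares `u^2 = 1 + pn` with `3u = 3 + ps` modulo
`p^2`. -/
theorem exists_aeval_polylogPoly_one (hp3 : 3 < p) {w : pIntegralSubring p} (hw : w ^ 2 = w - 1)
    {n : ℤ} (hn : (3 : ℤ) ^ (p - 1) = 1 + p * n) : ∃ s : pResidueRing p,
      3 * aeval (1 + modP p w) (polylogPoly p 1) = -(1 + modP p w ^ p) * s ∧
      9 * (n : pResidueRing p) = 6 * s := by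
  obtain ⟨Q, hQ, hQL⟩ := exists_lift_polylogPoly_one hp3
  obtain ⟨u, hu2, hu⟩ := exists_one_add_pow_prime hw hp3
  have hodd : Odd p := hp.out.odd_of_ne_two (by omega)
  have hp0 : (p : pIntegralSubring p) ≠ 0 := fun h => hp.out.ne_zero (by
    have := congrArg Subtype.val h
    push_cast at this
    exact_mod_cast this)
  have hv : (w ^ p) ^ 2 = w ^ p - 1 := by
    rcases pow_prime_of_sq (p := p) hw hp3 with ⟨-, h⟩ | ⟨-, h⟩ <;> rw [h]
    · exact hw
    · linear_combination hw
  have hev : -(w ^ p + 1) * (u - 1) = p * aeval (1 + w) Q := by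
    have := congrArg (aeval (1 + w)) hQ
    simp only [map_sub, map_one, map_pow, aeval_X, map_mul, map_natCast] at this
    rw [show 1 - (1 + w) = -w by ring, hodd.neg_pow] at this
    linear_combination this + hu
  -- Multiplication by `2 - w^p` turns the factor `1 + w^p` in `hev` into 3, so `3(u - 1)` is seen
  -- to be divisible by `p` without computing the sign of `u`.
  set s : pIntegralSubring p := -(aeval (1 + w) Q) * (2 - w ^ p) with hs
  have h3u : 3 * (u : pIntegralSubring p) = 3 + p * s := by
    rw [hs]
    linear_combination (w ^ p - 2) * hev + (u - 1) * hv
  have hun : (u : pIntegralSubring p) ^ 2 = 1 + p * n := by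
    have := congrArg (Int.cast (R := pIntegralSubring p)) (hu2.trans hn)
    push_cast at this
    exact this
  have h9 : 9 * (n : pIntegralSubring p) = 6 * s + p * s ^ 2 := by
    apply mul_left_cancel₀ hp0
    linear_combination -9 * hun + (3 * u + 3 + p * s) * h3u
  have hQR : modP p (aeval (1 + w) Q) = aeval (1 + modP p w) (polylogPoly p 1) := by
    rw [← hQL, aeval_def, aeval_def, eval₂_map, hom_eval₂, map_add, map_one]
    congr 1
    exact RingHom.ext_int _ _
  have hpR : (p : pResidueRing p) = 0 := CharP.cast_eq_zero _ p
  refine ⟨modP p s, ?_, ?_⟩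
  · rw [← hQR, ← map_pow, hs]
    have hv' := congrArg (modP p) hv
    simp only [map_sub, map_one, map_mul, map_neg, map_ofNat, map_pow] at hv' ⊢
    linear_combination (modP p (aeval (1 + w) Q)) * hv'
  · have := congrArg (modP p) h9
    simp only [map_add, map_mul, map_ofNat, map_intCast, map_natCast, map_pow] at this
    linear_combination this + (modP p s) ^ 2 * hpR

end SixthRoot

/-! ### The two congruences -/

theorem mainTheorem6 (p : ℕ) (hp : p.Prime) (hp3 : 3 < p)
    (ε : ℤ) (hε : ε = 1 ∨ ε = -1) :
    CongrModP p (finitePolylog p 2 (1 + omegaSix ^ ε))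
      (-(fermatQuotient p 3) ^ 2 / 16 *
          (3 + (ε : ℂ) * (Complex.I * (Real.sqrt 3 : ℂ)) * (legendreSym 3 (p : ℤ) : ℂ)) +
        1 / 36 * (3 * (legendreSym 3 (p : ℤ) : ℂ) - (ε : ℂ) * (Complex.I * (Real.sqrt 3 : ℂ))) *
          (((Polynomial.bernoulli (p - 2)).eval (1 / 3 : ℚ) : ℚ) : ℂ)) ∧
    CongrModP p (finitePolylog p 2 ((1 + omegaSix ^ ε) / 3))
      (-(fermatQuotient p 3) ^ 2 / 8 +
        1 / 36 * ((legendreSym 3 (p : ℤ) : ℂ) + (ε : ℂ) * (Complex.I * (Real.sqrt 3 : ℂ))) *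
          (((Polynomial.bernoulli (p - 2)).eval (1 / 3 : ℚ) : ℚ) : ℂ)) := by
  have : Fact p.Prime := ⟨hp⟩
  -- Once `±i√3` is written as `2w - 1`, both signs are covered by the single relation `w^2 = w -
  -- 1`.
  rw [← omegaSix_zpow_eq hε]
  have hw₀ := omegaSix_zpow_sq hε
  let w : pIntegralSubring p :=
    ⟨omegaSix ^ ε, (isIntegral_of_sq_eq_sub_one hw₀).mem_pIntegralSubring⟩
  have hw : w ^ 2 = w - 1 := Subtype.ext hw₀
  have hw' : (1 - w) ^ 2 = (1 - w) - 1 := by linear_combination hw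
  have hwR : modP p w ^ 2 = modP p w - 1 := by rw [← map_pow, hw, map_sub, map_one]
  have hwR' : (1 - modP p w) ^ 2 = (1 - modP p w) - 1 := by linear_combination hwR
  obtain ⟨n, hn, hnq⟩ := exists_fermatQuotient_three hp3
  obtain ⟨b, hb, hβ⟩ := exists_bernoulli_third hp3
  obtain ⟨s, hs, hns⟩ := exists_aeval_polylogPoly_one hp3 hw hn
  -- The conjugate root `1 - w` is needed for the second congruence.
  obtain ⟨s', hs', hns'⟩ := exists_aeval_polylogPoly_one hp3 hw' hn
  rw [map_sub, map_one] at hs'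
  have h144 : ¬ p ∣ 144 := not_dvd_two_pow_mul_three_pow hp3 4 2
  have h72 : ¬ p ∣ 72 := not_dvd_two_pow_mul_three_pow hp3 3 2
  have h3 : ¬ p ∣ 3 := not_dvd_two_pow_mul_three_pow hp3 0 1
  have i144 := natCast_mul_pIntegralInv h144
  have i72 := natCast_mul_pIntegralInv h72
  have i3 := natCast_mul_pIntegralInv h3
  obtain ⟨g₁, hg₁, hg₁R⟩ := exists_finitePolylog_lift 2 (1 + w)
  obtain ⟨g₂, hg₂, hg₂R⟩ := exists_finitePolylog_lift 2 (pIntegralInv p 3 * (1 + w))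
  have k₁ := aeval_polylogPoly_two_one_add hp3 hwR hs hns hβ
  have k₂ := aeval_polylogPoly_two_one_add_div_three hp3 (y := modP p (pIntegralInv p 3 * (1 + w)))
    hwR (by
      have := congrArg (modP p) i3
      rw [map_mul, map_natCast, map_one] at this
      rw [map_mul, map_add, map_one]
      push_cast at this
      linear_combination (1 + modP p w) * this)
    (aeval_polylogPoly_two_one_add hp3 hwR' hs' hns' hβ)
  have e1 : finitePolylog p 2 (1 + omegaSix ^ ε) = g₁ := by rw [hg₁]; rfl
  have e2 : finitePolylog p 2 ((1 + omegaSix ^ ε) / 3) = g₂ := by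
    rw [hg₂, Subring.coe_mul, coe_pIntegralInv h3, div_eq_inv_mul]; rfl
  -- The right-hand sides are written with the single denominators 144 and 72, both prime to `p`, so
  -- that they are elements of the subring and can be reduced.
  have r1 : -(fermatQuotient p 3) ^ 2 / 16 *
          (3 + (2 * omegaSix ^ ε - 1) * (legendreSym 3 (p : ℤ) : ℂ)) +
        1 / 36 * (3 * (legendreSym 3 (p : ℤ) : ℂ) - (2 * omegaSix ^ ε - 1)) *
          (((Polynomial.bernoulli (p - 2)).eval (1 / 3 : ℚ) : ℚ) : ℂ) =
      ((pIntegralInv p 144 * (-9 * (n : pIntegralSubring p) ^ 2 *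
        (3 + (2 * w - 1) * (legendreSym 3 (p : ℤ) : pIntegralSubring p)) +
        4 * (3 * (legendreSym 3 (p : ℤ) : pIntegralSubring p) - (2 * w - 1)) * b) :
        pIntegralSubring p) : ℂ) := by
    rw [Subring.coe_mul, coe_pIntegralInv h144, ← hnq, ← hb]
    change _ = _ * (-9 * (n : ℂ) ^ 2 *
        (3 + (2 * omegaSix ^ ε - 1) * (legendreSym 3 (p : ℤ) : ℂ)) +
        4 * (3 * (legendreSym 3 (p : ℤ) : ℂ) - (2 * omegaSix ^ ε - 1)) * b)
    push_cast
    ring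
  have r2 : -(fermatQuotient p 3) ^ 2 / 8 +
        1 / 36 * ((legendreSym 3 (p : ℤ) : ℂ) + (2 * omegaSix ^ ε - 1)) *
          (((Polynomial.bernoulli (p - 2)).eval (1 / 3 : ℚ) : ℚ) : ℂ) =
      ((pIntegralInv p 72 * (-9 * (n : pIntegralSubring p) ^ 2 +
        2 * ((legendreSym 3 (p : ℤ) : pIntegralSubring p) + (2 * w - 1)) * b) :
        pIntegralSubring p) : ℂ) := by
    rw [Subring.coe_mul, coe_pIntegralInv h72, ← hnq, ← hb]
    change _ = _ * (-9 * (n : ℂ) ^ 2 +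
        2 * ((legendreSym 3 (p : ℤ) : ℂ) + (2 * omegaSix ^ ε - 1)) * b)
    push_cast
    ring
  rw [e1, e2, r1, r2]
  constructor
  · apply congrModP_of_natCast_mul_modP_eq h144
    rw [← map_natCast (modP p) 144, ← map_mul (modP p) _ (_ * _), ← mul_assoc, i144, one_mul, hg₁R]
    simp only [map_add, map_mul, map_sub, map_neg, map_one, map_ofNat, map_pow, map_intCast,
      map_natCast]
    exact_mod_cast k₁
  · apply congrModP_of_natCast_mul_modP_eq h72
    rw [← map_natCast (modP p) 72, ← map_mul (modP p) _ (_ * _), ← mul_assoc, i72, one_mul, hg₂R]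
    simp only [map_add, map_sub, map_neg, map_one, map_ofNat, map_pow, map_intCast,
      map_natCast, map_mul] at k₂ ⊢
    exact_mod_cast k₂
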